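/- Let $T,S$ be unital rings and let $\mathcal M=(T,S,P,Q,\langle,\rangle_T,\langle,\rangle_S)$ be a unital Morita context: ${}_TP_S$ and ${}_SQ_T$ are bimodules, $\langle,\rangle_T:P\otimes_SQ\to T$ and $\langle,\rangle_S:Q\otimes_TP\to S$ are bimodule morphisms, and $\langle q,p\rangle_Sq'=q\langle p,q'\rangle_T$, $p\langle q,p'\rangle_S=\langle p,q\rangle_Tp'$ for all $p,p'\in P$, $q,q'\in Q$. Let $J=\mathrm{Im}\langle,\rangle_S$, let ${}_T\mathbf E$ be any injective cogenerator of the category of left $T$-modules, and let ${}_S^{\#}P=\mathrm{Hom}_T(P,\mathbf E)$ with $(sf)(p)=f(ps)$. Notation. For a left module $U$ over a ring: $\mathrm{Gen}(U)$, $\mathrm{Pres}(U)$, $\mathrm{Cogen}(U)$, $\mathrm{Copres}(U)$ are the classes of left modules $V$ admitting, for some sets $\Lambda,\Lambda'$, exact sequences $U^{(\Lambda)}\to V\to0$, $U^{(\Lambda')}\to U^{(\Lambda)}\to V\to0$, $0\to V\to U^{\Lambda}$, $0\to V\to U^{\Lambda}\to U^{\Lambda'}$, respectively. $\mathrm{Stat}^l({}_TP_S)$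 is the class of left $T$-modules $K$ whose evaluation map $P\otimes_S\mathrm{Hom}_T(P,K)\to K$ is bijective; $\mathrm{Adstat}^l({}_TP_S)$ is the class of left $S$-modules $L$ whose canonical map $L\to\mathrm{Hom}_T(P,P\otimes_SL)$ is bijective; ${}_J\mathcal L$ is the class of left $S$-modules $L$ whose canonical map $L\to\mathrm{Hom}_S(J,L)$ is bijective. The pair $\mathbf P_r=(Q,P_S)$ is an $\alpha$-pairing if $P\otimes_SU\to\mathrm{Hom}_S(Q,U)$, $p\otimes u\mapsto[q\mapsto\langle q,p\rangle_Su]$, is injective for every left $S$-module $U$; $\mathbf Q_r=(P,Q_T)$ is an $\alpha$-pairing if $Q\otimes_TU\to\mathrm{Hom}_T(P,U)$, $q\otimes u\mapsto[p\mapsto\langle p,q\rangle_Tu]$, is injective for every left $T$-module $U$. $\mathcal M$ satisfies the right $\alpha$-condition if both are. Classes of modules are regarded as full subcategories. A left $T$-module $P$ is: $\Sigma$-self-static if for every set $\Lambda$ the module $P^{(\Lambda)}$ lies in $\mathrm{Stat}^l({}_TP_{S'})$, where $S'=\mathrm{End}({}_TP)^{op}$; a $*$-module if $\mathrm{Hom}_T(P,-)$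 and $P\otimes_{S'}-$ induce an equivalence $\mathrm{Gen}({}_TP)\approx\mathrm{Cogen}({}_{S'}^{\#}P)$; self-tilting if $\mathrm{Gen}({}_TP)=\mathrm{Pres}({}_TP)$ and $\mathrm{Hom}_T(P,-)$ preserves exactness of every exact sequence $0\to K\to P^{(\Lambda)}\to V\to0$ of left $T$-modules with $K\in\mathrm{Gen}({}_TP)$; self-small if the canonical map $\mathrm{Hom}_T(P,P)^{(\Lambda)}\to\mathrm{Hom}_T(P,P^{(\Lambda)})$ is bijective for every set $\Lambda$. Proposition. 1. If $\mathbf P_r=(Q,P_S)$ is an $\alpha$-pairing, then: (a) $\mathrm{Gen}({}_TP)=\mathrm{Stat}^l({}_TP_S)$; (b) $\mathrm{Hom}_T(P,-)$ and $P\otimes_S-$ induce an equivalence of categories $\mathrm{Gen}({}_TP)\approx\mathrm{Copres}({}_S^{\#}P)$; (c) ${}_TP$ is $\Sigma$-self-static and $\mathrm{Stat}^l({}_TP_S)$ is closed under factor modules; (d) $\mathrm{Gen}({}_TP)=\mathrm{Pres}({}_TP)$. 2. If $\mathcal M$ satisfies the right $\alpha$-condition and $\mathrm{Cogen}({}_S^{\#}P)\subseteq{}_J\mathcal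 L$, then: (a) $\mathrm{Gen}({}_TP)=\mathrm{Stat}^l({}_TP_S)$ and $\mathrm{Cogen}({}_S^{\#}P)=\mathrm{Adstat}^l({}_TP_S)$; (b) $\mathrm{Hom}_T(P,-)$ and $P\otimes_S-$ induce an equivalence of categories $\mathrm{Gen}({}_TP)\approx\mathrm{Cogen}({}_S^{\#}P)$; (c) ${}_TP$ is a $*$-module; (d) ${}_TP$ is self-tilting and self-small. -/

import Mathlib

open CategoryTheory MulOpposite
open scoped TensorProduct

universe u

namespace StarModules

noncomputable section

/-! ### Tensor products over noncommutative rings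

Right `S`-modules are modules over `Sᵐᵒᵖ`; a `(T, S)`-bimodule is a left `T`-module that is a
right `S`-module with commuting actions (`SMulCommClass T Sᵐᵒᵖ P`). -/

section Tensor

variable (S : Type u) [Ring S] (W : Type u) [AddCommGroup W] [Module Sᵐᵒᵖ W]
  (L : Type u) [AddCommGroup L] [Module S L]

/-- The subgroup of `W ⊗ L` (over the integers) generated by all `ws ⊗ l - w ⊗ sl`. -/
def balRel : AddSubgroup (W ⊗[ℤ] L) :=
  AddSubgroup.closure
    {x | ∃ (w : W) (s : S) (l : L), x = (op s • w) ⊗ₜ[ℤ] l - w ⊗ₜ[ℤ] (s • l)}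

/-- The tensor product `W ⊗_S L` of a right `S`-module `W` and a left `S`-module `L`. -/
def BalTensor : Type u := (W ⊗[ℤ] L) ⧸ balRel S W L

instance : AddCommGroup (BalTensor S W L) :=
  inferInstanceAs (AddCommGroup ((W ⊗[ℤ] L) ⧸ balRel S W L))

namespace BalTensor

variable {W L}

/-- The pure tensor `w ⊗ l` in `W ⊗_S L`. -/
def tmul (w : W) (l : L) : BalTensor S W L :=
  QuotientAddGroup.mk' (balRel S W L) (w ⊗ₜ[ℤ] l)

theorem add_tmul (w w' : W) (l : L) : tmul S (w + w') l = tmul S w l + tmul S w' l := by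
  simp only [tmul, TensorProduct.add_tmul, map_add]
  rfl

theorem tmul_add (w : W) (l l' : L) : tmul S w (l + l') = tmul S w l + tmul S w l' := by
  simp only [tmul, TensorProduct.tmul_add, map_add]
  rfl

theorem smul_tmul (w : W) (s : S) (l : L) : tmul S (op s • w) l = tmul S w (s • l) := by
  refine (QuotientAddGroup.eq_iff_sub_mem (N := balRel S W L)).2 ?_
  exact AddSubgroup.subset_closure ⟨w, s, l, rfl⟩

@[elab_as_elim]
theorem induction_on {motive : BalTensor S W L → Prop} (x : BalTensor S W L)
    (zero : motive 0) (tmul : ∀ w l, motive (tmul S w l))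
    (add : ∀ x y, motive x → motive y → motive (x + y)) : motive x := by
  obtain ⟨y, rfl⟩ := QuotientAddGroup.mk'_surjective (balRel S W L) x
  induction y using TensorProduct.induction_on with
  | zero => exact zero
  | tmul w l => exact tmul w l
  | add a b ha hb => exact add _ _ ha hb

/-- The additive map on `W ⊗_S L` induced by a biadditive `S`-balanced map. -/
def lift {A : Type u} [AddCommGroup A] (f : W →+ L →+ A)
    (hf : ∀ (w : W) (s : S) (l : L), f (op s • w) l = f w (s • l)) : BalTensor S W L →+ A :=
  QuotientAddGroup.lift (balRel S W L)
    (TensorProduct.liftAddHom f (fun n w l => by simp)) (by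
      refine (AddSubgroup.closure_le _).2 ?_
      rintro x ⟨w, s, l, rfl⟩
      simp [hf])

@[simp]
theorem lift_tmul {A : Type u} [AddCommGroup A] (f : W →+ L →+ A)
    (hf : ∀ (w : W) (s : S) (l : L), f (op s • w) l = f w (s • l)) (w : W) (l : L) :
    lift S f hf (tmul S w l) = f w l := rfl

theorem addHom_ext {A : Type u} [AddCommGroup A] {f g : BalTensor S W L →+ A}
    (h : ∀ w l, f (tmul S w l) = g (tmul S w l)) : f = g := by
  ext x
  induction x using induction_on with
  | zero => simp
  | tmul w l => exact h w l
  | add x y hx hy => simp [hx, hy]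

variable {T : Type u} [Ring T] [Module T W] [SMulCommClass T Sᵐᵒᵖ W]

/-- Left multiplication by `t` on `W ⊗_S L`, sending `w ⊗ l` to `tw ⊗ l`. -/
def lsmul (t : T) : BalTensor S W L →+ BalTensor S W L :=
  lift S
    (AddMonoidHom.mk' (fun w => AddMonoidHom.mk' (fun l => tmul S (t • w) l)
      (fun l l' => tmul_add S _ l l'))
      (fun w w' => by ext l; simp [smul_add, add_tmul]))
    (fun w s l => by
      change tmul S (t • op s • w) l = tmul S (t • w) (s • l)
      rw [smul_comm, smul_tmul])

@[simp]
theorem lsmul_tmul (t : T) (w : W) (l : L) : lsmul S t (tmul S w l) = tmul S (t • w) l := rfl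

/-- The left `T`-module structure of `W ⊗_S L` for a `(T, S)`-bimodule `W`. -/
instance instLeftModule : Module T (BalTensor S W L) where
  smul t x := lsmul S t x
  one_smul x := by
    change lsmul S (1 : T) x = x
    exact DFunLike.congr_fun (addHom_ext S (f := lsmul S (1 : T)) (g := AddMonoidHom.id _)
      (fun w l => by simp)) x
  mul_smul t t' x := by
    change lsmul S (t * t') x = lsmul S t (lsmul S t' x)
    exact DFunLike.congr_fun (addHom_ext S (f := lsmul S (t * t'))
      (g := (lsmul S t).comp (lsmul S t')) (fun w l => by simp [mul_smul])) x
  smul_zero t := map_zero (lsmul S t)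
  smul_add t x y := map_add (lsmul S t) x y
  add_smul t t' x := by
    change lsmul S (t + t') x = lsmul S t x + lsmul S t' x
    exact DFunLike.congr_fun (addHom_ext S (f := lsmul S (t + t'))
      (g := lsmul S t + lsmul S t') (fun w l => by simp [add_smul, add_tmul])) x
  zero_smul x := by
    change lsmul S (0 : T) x = 0
    exact DFunLike.congr_fun (addHom_ext S (f := lsmul S (0 : T)) (g := 0)
      (fun w l => by
        have h := add_tmul S (0 : W) 0 l
        simp only [add_zero, left_eq_add] at h
        simp [h])) x

theorem tsmul_tmul (t : T) (w : W) (l : L) : t • tmul S w l = tmul S (t • w) l := rfl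

end BalTensor

end Tensor

/-! ### The adjoint pair attached to a bimodule -/

section Adjoint

variable (T S : Type u) [Ring T] [Ring S] (P : Type u) [AddCommGroup P] [Module T P]
  [Module Sᵐᵒᵖ P] [SMulCommClass T Sᵐᵒᵖ P]

/-- `Hom_T(P, M)` for a `(T, S)`-bimodule `P`, regarded as a left `S`-module. -/
def HomMod (M : Type u) [AddCommGroup M] [Module T M] : Type u :=
  let _ := S
  P →ₗ[T] M

instance (M : Type u) [AddCommGroup M] [Module T M] : AddCommGroup (HomMod T S P M) :=
  inferInstanceAs (AddCommGroup (P →ₗ[T] M))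

instance (M : Type u) [AddCommGroup M] [Module T M] : FunLike (HomMod T S P M) P M :=
  inferInstanceAs (FunLike (P →ₗ[T] M) P M)

/-- Right multiplication by `s` on `P`, as a left `T`-linear map. -/
def rmul (s : S) : P →ₗ[T] P where
  toFun p := op s • p
  map_add' := smul_add _
  map_smul' t p := (smul_comm t (op s) p).symm

/-- The left `S`-module structure `(s h)(p) = h(ps)`. -/
instance (M : Type u) [AddCommGroup M] [Module T M] : Module S (HomMod T S P M) where
  smul s h := LinearMap.comp (h : P →ₗ[T] M) (rmul T S P s)
  one_smul h := LinearMap.ext fun p => congrArg h (by simp : op (1 : S) • p = p)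
  mul_smul s s' h := LinearMap.ext fun p => congrArg h
    (by simp [mul_smul] : op (s * s') • p = op s' • op s • p)
  smul_zero _ := rfl
  smul_add _ _ _ := rfl
  add_smul s s' h := LinearMap.ext fun p =>
    (congrArg h (by simp [add_smul] : op (s + s') • p = op s • p + op s' • p)).trans
      (LinearMap.map_add (h : P →ₗ[T] M) _ _)
  zero_smul h := LinearMap.ext fun p =>
    (congrArg h (by simp : op (0 : S) • p = 0)).trans (LinearMap.map_zero (h : P →ₗ[T] M))

theorem HomMod.smul_apply (M : Type u) [AddCommGroup M] [Module T M] (s : S)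
    (h : HomMod T S P M) (p : P) : (s • h) p = h (op s • p) := rfl

/-- The functor `Hom_T(P, -)` from left `T`-modules to left `S`-modules. -/
def homFunctor : ModuleCat.{u} T ⥤ ModuleCat.{u} S where
  obj M := ModuleCat.of S (HomMod T S P M)
  map {M N} f := ModuleCat.ofHom
    { toFun := fun h => (f.hom.comp (h : P →ₗ[T] M) : P →ₗ[T] N)
      map_add' := fun h h' => LinearMap.comp_add (h : P →ₗ[T] M) (h' : P →ₗ[T] M) f.hom
      map_smul' := fun _ _ => rfl }

/-- The map `P ⊗_S L → P ⊗_S N` induced by an `S`-linear map `L → N`. -/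
def tensorMap {L N : Type u} [AddCommGroup L] [Module S L] [AddCommGroup N] [Module S N]
    (f : L →ₗ[S] N) : BalTensor S P L →ₗ[T] BalTensor S P N where
  toFun := BalTensor.lift S
    (AddMonoidHom.mk' (fun p => AddMonoidHom.mk' (fun l => BalTensor.tmul S p (f l))
      (fun l l' => by rw [map_add, BalTensor.tmul_add]))
      (fun p p' => AddMonoidHom.ext fun l => BalTensor.add_tmul S p p' (f l)))
    (fun p s l => by
      change BalTensor.tmul S (op s • p) (f l) = BalTensor.tmul S p (f (s • l))
      rw [map_smul, BalTensor.smul_tmul])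
  map_add' := map_add _
  map_smul' t x := by
    induction x using BalTensor.induction_on with
    | zero => simp
    | tmul p l => rfl
    | add x y hx hy => simp only [smul_add, map_add, hx, hy]

/-- The functor `P ⊗_S -` from left `S`-modules to left `T`-modules. -/
def tensorFunctor : ModuleCat.{u} S ⥤ ModuleCat.{u} T where
  obj L := ModuleCat.of T (BalTensor S P L)
  map f := ModuleCat.ofHom (tensorMap T S P f.hom)
  map_id L := by
    ext x
    induction x using BalTensor.induction_on with
    | zero => simp
    | tmul p l => rfl
    | add x y hx hy => rw [map_add, hx, hy, map_add]
  map_comp f g := by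
    ext x
    induction x using BalTensor.induction_on with
    | zero => simp
    | tmul p l => rfl
    | add x y hx hy => rw [map_add, hx, hy, map_add]

/-- The canonical `T`-linear map `P ⊗_S Hom_T(P, K) → K`, `p ⊗ h ↦ h(p)`. -/
def omega (K : Type u) [AddCommGroup K] [Module T K] :
    BalTensor S P (HomMod T S P K) →ₗ[T] K where
  toFun := BalTensor.lift S
    (AddMonoidHom.mk' (fun p => AddMonoidHom.mk' (fun h : HomMod T S P K => h p)
      (fun _ _ => rfl))
      (fun p p' => AddMonoidHom.ext fun h => LinearMap.map_add (h : P →ₗ[T] K) p p'))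
    (fun _ _ _ => rfl)
  map_add' := map_add _
  map_smul' t x := by
    induction x using BalTensor.induction_on with
    | zero => simp
    | tmul p h => exact LinearMap.map_smul (h : P →ₗ[T] K) t p
    | add x y hx hy => simp only [smul_add, map_add, hx, hy]

/-- The canonical `S`-linear map `L → Hom_T(P, P ⊗_S L)`, `l ↦ (p ↦ p ⊗ l)`. -/
def eta (L : Type u) [AddCommGroup L] [Module S L] :
    L →ₗ[S] HomMod T S P (BalTensor S P L) where
  toFun l := ({ toFun := fun p => BalTensor.tmul S p l
                map_add' := fun p p' => BalTensor.add_tmul S p p' l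
                map_smul' := fun _ _ => rfl } : P →ₗ[T] BalTensor S P L)
  map_add' l l' := LinearMap.ext fun p => BalTensor.tmul_add S p l l'
  map_smul' s l := LinearMap.ext fun p => (BalTensor.smul_tmul S p s l).symm

/-- `Stat^l(_T P_S)`: the left `T`-modules `K` for which `P ⊗_S Hom_T(P, K) → K` is bijective. -/
def Stat : ObjectProperty (ModuleCat.{u} T) := fun K => Function.Bijective (omega T S P K)

/-- `Adstat^l(_T P_S)`: the left `S`-modules `L` for which `L → Hom_T(P, P ⊗_S L)` is
bijective. -/
def Adstat : ObjectProperty (ModuleCat.{u} S) := fun L => Function.Bijective (eta T S P L)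

/-- The functors `Hom_T(P, -)` and `P ⊗_S -` restrict to mutually inverse equivalences between
the full subcategories `C` of left `T`-modules and `D` of left `S`-modules. -/
def InducesEquivalence (C : ObjectProperty (ModuleCat.{u} T))
    (D : ObjectProperty (ModuleCat.{u} S)) : Prop :=
  ∃ e : C.FullSubcategory ≌ D.FullSubcategory,
    Nonempty (e.functor ⋙ D.ι ≅ C.ι ⋙ homFunctor T S P) ∧
    Nonempty (e.inverse ⋙ C.ι ≅ D.ι ⋙ tensorFunctor T S P)

end Adjoint

/-! ### Generated, cogenerated, presented and copresented modules -/

section Classes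

variable (T : Type u) [Ring T] (U : Type u) [AddCommGroup U] [Module T U]

/-- `Gen(U)`: there is an exact sequence `U^(Λ) → V → 0`. -/
def Gen : ObjectProperty (ModuleCat.{u} T) := fun V =>
  ∃ (Λ : Type u) (f : (Λ →₀ U) →ₗ[T] V), Function.Surjective f

/-- `Cogen(U)`: there is an exact sequence `0 → W → U^Λ`. -/
def Cogen : ObjectProperty (ModuleCat.{u} T) := fun W =>
  ∃ (Λ : Type u) (f : W →ₗ[T] (Λ → U)), Function.Injective f

/-- `Pres(U)`: there is an exact sequence `U^(Λ₂) → U^(Λ₁) → V → 0`. -/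
def Pres : ObjectProperty (ModuleCat.{u} T) := fun V =>
  ∃ (Λ₁ Λ₂ : Type u) (g : (Λ₂ →₀ U) →ₗ[T] (Λ₁ →₀ U)) (f : (Λ₁ →₀ U) →ₗ[T] V),
    Function.Exact g f ∧ Function.Surjective f

/-- `Copres(U)`: there is an exact sequence `0 → W → U^Λ₁ → U^Λ₂`. -/
def Copres : ObjectProperty (ModuleCat.{u} T) := fun W =>
  ∃ (Λ₁ Λ₂ : Type u) (f : W →ₗ[T] (Λ₁ → U)) (g : (Λ₁ → U) →ₗ[T] (Λ₂ → U)),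
    Function.Injective f ∧ Function.Exact f g

/-- `U` is a cogenerator: every left `T`-module is `U`-cogenerated. -/
def IsCogenerator : Prop := ∀ W : ModuleCat.{u} T, Cogen T U W

/-- `U` is weakly `Σ`-quasi-projective: `Hom_T(U, -)` preserves exactness of every exact sequence
`0 → K → U^(Λ) → V → 0` with `K` in `Gen(U)`. -/
def WeaklySigmaQuasiProjective : Prop :=
  ∀ (Λ : Type u) (K V : ModuleCat.{u} T) (i : K →ₗ[T] (Λ →₀ U)) (g : (Λ →₀ U) →ₗ[T] V),
    Gen T U K → Function.Injective i → Function.Exact i g → Function.Surjective g →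
      Function.Injective (fun h : U →ₗ[T] K => i.comp h) ∧
      Function.Exact (fun h : U →ₗ[T] K => i.comp h)
        (fun h : U →ₗ[T] (Λ →₀ U) => g.comp h) ∧
      Function.Surjective (fun h : U →ₗ[T] (Λ →₀ U) => g.comp h)

/-- `U` is self-tilting. -/
def SelfTilting : Prop := WeaklySigmaQuasiProjective T U ∧ Gen T U = Pres T U

/-- `U` is self-small: for every set `Λ` the canonical map from the direct sum of `Λ` copies of
`Hom_T(U, U)` to `Hom_T(U, U^(Λ))` is bijective. -/
def SelfSmall : Prop :=
  ∀ Λ : Type u, Function.Bijective (fun f : Λ →₀ (U →ₗ[T] U) =>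
    (f.sum fun a h => (Finsupp.lsingle a).comp h : U →ₗ[T] (Λ →₀ U)))

/-- `U` as a right module over the ring `End(_T U)^op`. -/
instance endOpRightModule : Module (Module.End T U)ᵐᵒᵖᵐᵒᵖ U :=
  Module.compHom U (RingEquiv.opOp (Module.End T U)).symm.toRingHom

theorem op_op_smul (f : Module.End T U) (x : U) : op (op f) • x = f x := rfl

instance endOpRight_smulComm : SMulCommClass T (Module.End T U)ᵐᵒᵖᵐᵒᵖ U where
  smul_comm t s x := (LinearMap.map_smul (unop (unop s)) t x).symm

/-- `U` is `Σ`-self-static: every direct sum `U^(Λ)` is `U`-static (over `End(_T U)^op`). -/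
def SigmaSelfStatic : Prop :=
  ∀ Λ : Type u, Stat T (Module.End T U)ᵐᵒᵖ U (ModuleCat.of T (Λ →₀ U))

/-- `U` is a `*`-module: with `S = End(_T U)^op`, the functors `Hom_T(U, -)` and `U ⊗_S -` induce
an equivalence between `Gen(_T U)` and `Cogen(_S Hom_T(U, E))`, where `E` is the chosen injective
cogenerator. -/
def IsStarModule (E : Type u) [AddCommGroup E] [Module T E] : Prop :=
  InducesEquivalence T (Module.End T U)ᵐᵒᵖ U (Gen T U)
    (Cogen (Module.End T U)ᵐᵒᵖ (HomMod T (Module.End T U)ᵐᵒᵖ U E))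

end Classes

/-! ### Dual pairings and the `α`-condition -/

/-- A dual right `S`-pairing `(V, W_S)`: a left `S`-module `V`, a right `S`-module `W` and a left
`S`-linear map `V → Hom_{-S}(W, S)`, written as a biadditive map `(v, w) ↦ ⟨v, w⟩`. -/
structure RightPairing (S : Type u) [Ring S] (V : Type u) [AddCommGroup V] [Module S V]
    (W : Type u) [AddCommGroup W] [Module Sᵐᵒᵖ W] where
  form : V →+ W →+ S
  smul_left : ∀ (s : S) (v : V) (w : W), form (s • v) w = s * form v w
  smul_right : ∀ (v : V) (w : W) (s : S), form v (op s • w) = form v w * s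

namespace RightPairing

variable {S : Type u} [Ring S] {V : Type u} [AddCommGroup V] [Module S V]
  {W : Type u} [AddCommGroup W] [Module Sᵐᵒᵖ W]

/-- The map `W ⊗_S U → Hom_S(V, U)`, `w ⊗ x ↦ (v ↦ ⟨v, w⟩ x)`. -/
def alpha (B : RightPairing S V W) (U : Type u) [AddCommGroup U] [Module S U] :
    BalTensor S W U →+ (V →ₗ[S] U) :=
  BalTensor.lift S
    (AddMonoidHom.mk' (fun w => AddMonoidHom.mk' (fun x =>
      { toFun := fun v => B.form v w • x
        map_add' := fun v v' => by simp [add_smul]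
        map_smul' := fun s v => by simp [B.smul_left, mul_smul] })
      (fun x x' => by ext v; simp))
      (fun w w' => by ext x v; simp [add_smul]))
    (fun w s x => by ext v; simp [B.smul_right, mul_smul])

/-- The right `α`-condition: `alpha` is injective for every left `S`-module `U`. -/
def IsAlpha (B : RightPairing S V W) : Prop :=
  ∀ U : ModuleCat.{u} S, Function.Injective (B.alpha U)

end RightPairing

/-! ### Morita contexts -/

/-- A unital Morita context on the rings `T`, `S` and the bimodules `_T P_S`, `_S Q_T`. The bimodule
maps `P ⊗_S Q → T` and `Q ⊗_T P → S` are given as balanced biadditive maps. -/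
structure MoritaContext (T S : Type u) [Ring T] [Ring S]
    (P : Type u) [AddCommGroup P] [Module T P] [Module Sᵐᵒᵖ P] [SMulCommClass T Sᵐᵒᵖ P]
    (Q : Type u) [AddCommGroup Q] [Module S Q] [Module Tᵐᵒᵖ Q] [SMulCommClass S Tᵐᵒᵖ Q] where
  formT : P →+ Q →+ T
  formT_balanced : ∀ p (s : S) q, formT (op s • p) q = formT p (s • q)
  formT_smul_left : ∀ (t : T) p q, formT (t • p) q = t * formT p q
  formT_smul_right : ∀ p q (t : T), formT p (op t • q) = formT p q * t
  formS : Q →+ P →+ S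
  formS_balanced : ∀ q (t : T) p, formS (op t • q) p = formS q (t • p)
  formS_smul_left : ∀ (s : S) q p, formS (s • q) p = s * formS q p
  formS_smul_right : ∀ q p (s : S), formS q (op s • p) = formS q p * s
  compat_Q : ∀ q p q', formS q p • q' = op (formT p q') • q
  compat_P : ∀ p q p', op (formS q p') • p = formT p q • p'

namespace MoritaContext

variable {T S : Type u} [Ring T] [Ring S]
  {P : Type u} [AddCommGroup P] [Module T P] [Module Sᵐᵒᵖ P] [SMulCommClass T Sᵐᵒᵖ P]
  {Q : Type u} [AddCommGroup Q] [Module S Q] [Module Tᵐᵒᵖ Q] [SMulCommClass S Tᵐᵒᵖ Q]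
  (M : MoritaContext T S P Q)

/-- The dual right `S`-pairing `P_r = (Q, P_S)`. -/
def pairingP : RightPairing S Q P where
  form := M.formS
  smul_left := M.formS_smul_left
  smul_right := M.formS_smul_right

/-- The dual right `T`-pairing `Q_r = (P, Q_T)`. -/
def pairingQ : RightPairing T P Q where
  form := M.formT
  smul_left := M.formT_smul_left
  smul_right := M.formT_smul_right

/-- The right `α`-condition for a Morita context. -/
def RightAlpha : Prop := M.pairingQ.IsAlpha ∧ M.pairingP.IsAlpha

/-- The trace ideal `J`, the image of `Q ⊗_T P → S`, as a left ideal of `S`. (The additive span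
of the elements `⟨q, p⟩` is already closed under left and right multiplication by `S`.) -/
def traceS : Ideal S := Submodule.span S {x | ∃ q p, x = M.formS q p}

end MoritaContext

/-- For an ideal `J` of `S`, the class `_J𝓛` of left `S`-modules `L` for which the canonical map
`L → Hom_S(J, L)`, `l ↦ (j ↦ j l)`, is bijective. -/
def Localized {S : Type u} [Ring S] (J : Ideal S) : ObjectProperty (ModuleCat.{u} S) := fun L =>
  Function.Bijective (fun l : L => ((LinearMap.toSpanSingleton S L l).comp J.subtype : J →ₗ[S] L))

end

end StarModules

/-!
The functors `G = Hom_T(P, -)` and `F = P ⊗_S -` are adjoint, with counit `omega` and unit `eta`, so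
they restrict to an equivalence between static and adstatic modules
(`inducesEquivalence_stat_adstat`). The theorem amounts to identifying these two classes.

Let `(Q, P_S)` be an `α`-pairing. For `x ∈ P ⊗_S Hom_T(P, K)` the compatibility of the two forms
gives `alpha(x)(q)(p) = ⟨p, q⟩ omega(x)` (`MoritaContext.alpha_homMod_apply`). Since `alpha` is
injective, so is every counit, and `K` is static exactly when `omega` is onto, that is, when `K` is
`P`-generated (`MoritaContext.gen_eq_stat`). The same formula shows that an element `v` of a
`P`-generated module vanishes once all `⟨p, q⟩ v` do. Applied to a quotient, this places `v` in the
span of the elements `⟨p, q⟩ v`, so submodules of `P`-generated modules are `P`-generated and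
`Gen(P) = Pres(P)` (`MoritaContext.gen_eq_pres`). Finally `alpha` embeds `F` into the left exact
functor `Hom_S(Q, -)`, so `F` preserves injections. The unit is invertible on every `G K`, hence on
kernels of maps between such modules, whence `Copres(Hom_T(P, E)) ⊆ Adstat`
(`MoritaContext.copres_le_adstat`); the opposite inclusion follows by applying `G` to a
copresentation of `P ⊗_S L` by the cogenerator `E` (`adstat_le_copres`). The identifications persist
over `S' = End(_T P)^op`, because `P ⊗_S L → P ⊗_{S'} L` is bijective for every `S'`-module `L`
(`MoritaContext.toEndTensor_injective`).

If `(P, Q_T)` is an `α`-pairing as well, then `Q ⊗_T P → J` is an isomorphism. A map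
`g : P → P ⊗_S L` induces `J ≅ Q ⊗_T P → L`; for `L` in `_J𝓛` this is multiplication by some
`l ∈ L`, and injectivity of `alpha` turns that into `g = eta l`. So `_J𝓛 ⊆ Adstat`
(`MoritaContext.localized_le_adstat`), and `Cogen(Hom_T(P, E)) = Adstat` under the hypothesis of the
second part. Now let `C ⊆ Hom_T(P, V)` be an `S`-submodule whose members jointly generate `V`. It is
adstatic, and `P ⊗_S C → V` is bijective, which forces `C = Hom_T(P, V)`
(`MoritaContext.submodule_homMod_eq_top`). Taking for `C` the maps that lift along
`P^(Λ) → V`, or the maps into `P^(Λ)` with values in a finite subsum, gives the tilting property and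
self-smallness.
-/

namespace StarModules

/-! ### The adjoint pair of a bimodule -/

section Bimodule

theorem HomMod.ext {T S P K : Type u} [Ring T] [AddCommGroup P] [Module T P] [AddCommGroup K]
    [Module T K] {h h' : HomMod T S P K} (H : ∀ p, h p = h' p) : h = h' :=
  LinearMap.ext H

theorem HomMod.apply_add {T S P K : Type u} [Ring T] [AddCommGroup P] [Module T P]
    [AddCommGroup K] [Module T K] (h : HomMod T S P K) (p p' : P) : h (p + p') = h p + h p' :=
  LinearMap.map_add (h : P →ₗ[T] K) p p'

theorem HomMod.apply_smul {T S P K : Type u} [Ring T] [AddCommGroup P] [Module T P]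
    [AddCommGroup K] [Module T K] (h : HomMod T S P K) (t : T) (p : P) : h (t • p) = t • h p :=
  LinearMap.map_smul (h : P →ₗ[T] K) t p

variable {T S : Type u} [Ring T] [Ring S] {P : Type u} [AddCommGroup P] [Module T P]
  [Module Sᵐᵒᵖ P] [SMulCommClass T Sᵐᵒᵖ P]

namespace HomMod

variable {K K' : Type u} [AddCommGroup K] [Module T K] [AddCommGroup K'] [Module T K']

/-- Composition with a `T`-linear map, as an `S`-linear map between the modules `Hom_T(P, -)`. -/
def map (f : K →ₗ[T] K') : HomMod T S P K →ₗ[S] HomMod T S P K' :=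
  ((homFunctor T S P).map (ModuleCat.ofHom f)).hom

theorem map_apply (f : K →ₗ[T] K') (h : HomMod T S P K) (p : P) :
    map f h p = f (h p) := rfl

theorem map_injective {f : K →ₗ[T] K'} (hf : Function.Injective f) :
    Function.Injective (map f : HomMod T S P K →ₗ[S] HomMod T S P K') :=
  fun _ _ e => ext fun p => hf (DFunLike.congr_fun e p)

/-- `Hom_T(P, -)` commutes with products of copies of one module. -/
def piEquiv (ι : Type u) : HomMod T S P (ι → K) ≃ₗ[S] (ι → HomMod T S P K) where
  toFun h := fun i => map (LinearMap.proj i) h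
  invFun h := (LinearMap.pi h : P →ₗ[T] (ι → K))
  map_add' _ _ := rfl
  map_smul' _ _ := rfl
  left_inv _ := rfl
  right_inv _ := rfl

end HomMod

theorem HomMod.exact_map {K K' : Type u} [AddCommGroup K] [Module T K] [AddCommGroup K']
    [Module T K'] {N : Type u} [AddCommGroup N] [Module T N] {i : N →ₗ[T] K} {g : K →ₗ[T] K'}
    (hi : Function.Injective i) (hig : Function.Exact i g) :
    Function.Exact (HomMod.map i : HomMod T S P N →ₗ[S] _)
      (HomMod.map g : HomMod T S P K →ₗ[S] HomMod T S P K') := by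
  intro h
  constructor
  · intro e
    have hmem : ∀ p, h p ∈ LinearMap.range i := fun p => (hig _).1 (DFunLike.congr_fun e p)
    refine ⟨((LinearEquiv.ofInjective i hi).symm.toLinearMap.comp
      (LinearMap.codRestrict (LinearMap.range i) (h : P →ₗ[T] K) hmem) : P →ₗ[T] N), ?_⟩
    refine HomMod.ext fun p => ?_
    exact congrArg Subtype.val ((LinearEquiv.ofInjective i hi).apply_symm_apply ⟨h p, hmem p⟩)
  · rintro ⟨h, rfl⟩
    exact HomMod.ext fun p => hig.apply_apply_eq_zero (h p)

section TensorHom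

variable {K K' L N : Type u} [AddCommGroup K] [Module T K] [AddCommGroup K'] [Module T K']
  [AddCommGroup L] [Module S L] [AddCommGroup N] [Module S N]

theorem omega_tmul (p : P) (h : HomMod T S P K) :
    omega T S P K (BalTensor.tmul S p h) = h p := rfl

theorem tensorMap_tmul (f : L →ₗ[S] N) (p : P) (l : L) :
    tensorMap T S P f (BalTensor.tmul S p l) = BalTensor.tmul S p (f l) := rfl

theorem eta_apply (l : L) (p : P) : eta T S P L l p = BalTensor.tmul S p l := rfl

theorem omega_tensorMap (f : K →ₗ[T] K') (x : BalTensor S P (HomMod T S P K)) :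
    omega T S P K' (tensorMap T S P (HomMod.map f) x) = f (omega T S P K x) := by
  induction x using BalTensor.induction_on with
  | zero => simp
  | tmul p h => rfl
  | add x y hx hy => simp only [map_add, hx, hy]

theorem eta_naturality (f : L →ₗ[S] N) (l : L) :
    eta T S P N (f l) = HomMod.map (tensorMap T S P f) (eta T S P L l) := rfl

theorem omega_tensorMap_eta (x : BalTensor S P L) :
    omega T S P _ (tensorMap T S P (eta T S P L) x) = x := by
  induction x using BalTensor.induction_on with
  | zero => simp
  | tmul p h => rfl
  | add x y hx hy => simp only [map_add, hx, hy]

theorem tensorMap_surjective {f : L →ₗ[S] N} (hf : Function.Surjective f) :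
    Function.Surjective (tensorMap T S P f) := by
  intro x
  induction x using BalTensor.induction_on with
  | zero => exact ⟨0, map_zero _⟩
  | tmul p h =>
    obtain ⟨l, rfl⟩ := hf h
    exact ⟨BalTensor.tmul S p l, rfl⟩
  | add x y hx hy =>
    obtain ⟨x, rfl⟩ := hx
    obtain ⟨y, rfl⟩ := hy
    exact ⟨x + y, map_add _ _ _⟩

theorem eta_bijective_of_omega_injective (hK : Function.Injective (omega T S P K)) :
    Function.Bijective (eta T S P (HomMod T S P K)) := by
  refine ⟨fun h h' e => HomMod.ext fun p => ?_, fun g => ⟨HomMod.map (omega T S P K) g, ?_⟩⟩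
  · simpa only [eta_apply, omega_tmul] using congrArg (omega T S P K) (DFunLike.congr_fun e p)
  · exact HomMod.ext fun p => hK rfl

theorem omega_bijective_of_eta_bijective (hL : Function.Bijective (eta T S P L)) :
    Function.Bijective (omega T S P (BalTensor S P L)) := by
  refine ⟨(injective_iff_map_eq_zero _).2 fun x hx => ?_,
    fun x => ⟨_, omega_tensorMap_eta x⟩⟩
  obtain ⟨y, rfl⟩ := tensorMap_surjective (T := T) (P := P) hL.2 x
  rw [omega_tensorMap_eta] at hx
  rw [hx, map_zero]

end TensorHom

variable (T S P) in
/-- The unit and the counit of the adjunction are invertible on the adstatic and on the static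
modules, and each of the two functors maps one class into the other by the triangle identities. -/
theorem inducesEquivalence_stat_adstat :
    InducesEquivalence T S P (Stat T S P) (Adstat T S P) := by
  let G : (Stat T S P).FullSubcategory ⥤ (Adstat T S P).FullSubcategory :=
    (Adstat T S P).lift ((Stat T S P).ι ⋙ homFunctor T S P)
      (fun K => eta_bijective_of_omega_injective K.property.1)
  let F : (Adstat T S P).FullSubcategory ⥤ (Stat T S P).FullSubcategory :=
    (Stat T S P).lift ((Adstat T S P).ι ⋙ tensorFunctor T S P)
      (fun L => omega_bijective_of_eta_bijective L.property)
  let counit : G ⋙ F ≅ 𝟭 _ := NatIso.ofComponents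
    (fun K => ObjectProperty.isoMk _
      (LinearEquiv.ofBijective (omega T S P K.obj) K.property).toModuleIso)
    (fun {K K'} f => by
      apply ObjectProperty.hom_ext
      ext x
      exact omega_tensorMap f.hom.hom x)
  let unit : 𝟭 _ ≅ F ⋙ G := NatIso.ofComponents
    (fun L => ObjectProperty.isoMk _
      (LinearEquiv.ofBijective (eta T S P L.obj) L.property).toModuleIso)
    (fun {L L'} f => by
      apply ObjectProperty.hom_ext
      ext x
      rfl)
  exact ⟨(CategoryTheory.Equivalence.mk F G unit counit).symm, ⟨Iso.refl _⟩, ⟨Iso.refl _⟩⟩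

theorem stat_le_gen : Stat T S P ≤ Gen T P := by
  intro V hV
  let f : (HomMod T S P V →₀ P) →ₗ[T] V :=
    Finsupp.lsum ℕ fun h : HomMod T S P V => (h : P →ₗ[T] V)
  refine ⟨HomMod T S P V, f, LinearMap.range_eq_top.1 (top_unique fun v _ => ?_)⟩
  obtain ⟨x, rfl⟩ := hV.2 v
  induction x using BalTensor.induction_on with
  | zero => rw [map_zero]; exact zero_mem _
  | tmul p h => exact ⟨Finsupp.single h p,
      Finsupp.sum_single_index (LinearMap.map_zero (h : P →ₗ[T] V))⟩
  | add x y hx hy => rw [map_add]; exact add_mem (hx trivial) (hy trivial)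

theorem omega_surjective_of_gen {V : ModuleCat.{u} T} (hV : Gen T P V) :
    Function.Surjective (omega T S P V) := by
  obtain ⟨Λ, f, hf⟩ := hV
  intro v
  obtain ⟨y, rfl⟩ := hf v
  change f y ∈ LinearMap.range (omega T S P V)
  induction y using Finsupp.induction_linear with
  | zero => rw [map_zero]; exact zero_mem _
  | add y z hy hz => rw [map_add]; exact add_mem hy hz
  | single a p =>
    exact ⟨BalTensor.tmul S p (f.comp (Finsupp.lsingle a) : P →ₗ[T] V), rfl⟩

theorem gen_quotient {V V' : ModuleCat.{u} T} (f : V →ₗ[T] V') (hf : Function.Surjective f)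
    (hV : Gen T P V) : Gen T P V' := by
  obtain ⟨Λ, g, hg⟩ := hV
  exact ⟨Λ, f.comp g, hf.comp hg⟩

theorem pres_le_gen : Pres T P ≤ Gen T P :=
  fun _ ⟨Λ, _, _, f, _, hf⟩ => ⟨Λ, f, hf⟩

section Cogenerator

variable {E : Type u} [AddCommGroup E] [Module T E]

theorem cogen_homMod_iff {L : ModuleCat.{u} S} :
    Cogen S (HomMod T S P E) L ↔
      ∃ (Λ : Type u) (f : L →ₗ[S] HomMod T S P (Λ → E)), Function.Injective f :=
  ⟨fun ⟨Λ, f, hf⟩ => ⟨Λ, (HomMod.piEquiv Λ).symm.toLinearMap.comp f,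
      (HomMod.piEquiv Λ).symm.injective.comp hf⟩,
    fun ⟨Λ, f, hf⟩ => ⟨Λ, (HomMod.piEquiv Λ).toLinearMap.comp f,
      (HomMod.piEquiv Λ).injective.comp hf⟩⟩

theorem cogen_homMod_of_injective (hE : IsCogenerator T E) {L : ModuleCat.{u} S}
    {V : ModuleCat.{u} T} (f : L →ₗ[S] HomMod T S P V) (hf : Function.Injective f) :
    Cogen S (HomMod T S P E) L := by
  obtain ⟨Λ, g, hg⟩ := hE V
  exact cogen_homMod_iff.2 ⟨Λ, (HomMod.map g).comp f, (HomMod.map_injective hg).comp hf⟩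

theorem copres_le_cogen : Copres S (HomMod T S P E) ≤ Cogen S (HomMod T S P E) :=
  fun _ ⟨Λ, _, f, _, hf, _⟩ => ⟨Λ, f, hf⟩

/-- A copresentation of `P ⊗_S L` by the cogenerator `E` is mapped by the left exact functor
`Hom_T(P, -)` to a copresentation of `L ≅ Hom_T(P, P ⊗_S L)`. -/
theorem adstat_le_copres (hE : IsCogenerator T E) :
    Adstat T S P ≤ Copres S (HomMod T S P E) := by
  intro L hL
  obtain ⟨Λ₁, f₀, hf₀⟩ := hE (ModuleCat.of T (BalTensor S P L))
  obtain ⟨Λ₂, f₁, hf₁⟩ := hE (ModuleCat.of T ((Λ₁ → E) ⧸ LinearMap.range f₀))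
  have hex : Function.Exact f₀ (f₁.comp (LinearMap.range f₀).mkQ) := by
    intro y
    rw [LinearMap.comp_apply, map_eq_zero_iff f₁ hf₁]
    exact Submodule.Quotient.mk_eq_zero _
  have hmap := HomMod.exact_map (S := S) (P := P) hf₀ hex
  refine ⟨Λ₁, Λ₂, (HomMod.piEquiv Λ₁).toLinearMap.comp
      ((HomMod.map f₀).comp (eta T S P L)),
    (HomMod.piEquiv Λ₂).toLinearMap.comp ((HomMod.map (f₁.comp (LinearMap.range f₀).mkQ)).comp
      (HomMod.piEquiv Λ₁).symm.toLinearMap), ?_, ?_⟩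
  · exact (HomMod.piEquiv Λ₁).injective.comp ((HomMod.map_injective hf₀).comp hL.1)
  · intro y
    obtain ⟨y, rfl⟩ := (HomMod.piEquiv Λ₁).surjective y
    simp only [LinearMap.comp_apply, LinearEquiv.coe_coe, LinearEquiv.symm_apply_apply,
      LinearEquiv.map_eq_zero_iff]
    rw [hmap y]
    constructor
    · rintro ⟨h, rfl⟩
      obtain ⟨l, rfl⟩ := hL.2 h
      exact ⟨l, rfl⟩
    · rintro ⟨l, hl⟩
      exact ⟨_, (HomMod.piEquiv Λ₁).injective hl⟩

end Cogenerator

end Bimodule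

namespace MoritaContext

variable {T S : Type u} [Ring T] [Ring S]
  {P : Type u} [AddCommGroup P] [Module T P] [Module Sᵐᵒᵖ P] [SMulCommClass T Sᵐᵒᵖ P]
  {Q : Type u} [AddCommGroup Q] [Module S Q] [Module Tᵐᵒᵖ Q] [SMulCommClass S Tᵐᵒᵖ Q]
  (M : MoritaContext T S P Q)

/-! ### Consequences of the `α`-condition on `(Q, P_S)` -/

section Alpha

theorem alpha_tmul {L : Type u} [AddCommGroup L] [Module S L] (p : P) (l : L) (q : Q) :
    M.pairingP.alpha L (BalTensor.tmul S p l) q = M.formS q p • l := rfl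

theorem alpha_naturality {L N : Type u} [AddCommGroup L] [Module S L] [AddCommGroup N]
    [Module S N] (f : L →ₗ[S] N) (x : BalTensor S P L) (q : Q) :
    M.pairingP.alpha N (tensorMap T S P f x) q = f (M.pairingP.alpha L x q) := by
  induction x using BalTensor.induction_on with
  | zero => simp
  | tmul p l => rw [tensorMap_tmul, alpha_tmul, alpha_tmul, map_smul]
  | add x y hx hy => simp only [map_add, LinearMap.add_apply, hx, hy]

/-- On `P ⊗_S Hom_T(P, K)` the map `alpha` depends only on `omega x`. This is where the
compatibility `p ⟨q, p'⟩ = ⟨p, q⟩ p'` of the Morita context enters. -/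
theorem alpha_homMod_apply {K : Type u} [AddCommGroup K] [Module T K]
    (x : BalTensor S P (HomMod T S P K)) (q : Q) (p : P) :
    (M.pairingP.alpha (HomMod T S P K) x q : HomMod T S P K) p =
      M.formT p q • omega T S P K x := by
  induction x using BalTensor.induction_on with
  | zero => simp; rfl
  | tmul p' h =>
    rw [alpha_tmul, HomMod.smul_apply, M.compat_P]
    exact LinearMap.map_smul (h : P →ₗ[T] K) _ _
  | add x y hx hy =>
    rw [map_add, map_add, smul_add, ← hx, ← hy]
    rfl

variable {M} (hα : M.pairingP.IsAlpha)
include hα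

/-- The functor `P ⊗_S -` is left exact: `alpha` embeds it into `Hom_S(Q, -)`. -/
theorem tensorMap_injective {L N : Type u} [AddCommGroup L] [Module S L] [AddCommGroup N]
    [Module S N] {f : L →ₗ[S] N} (hf : Function.Injective f) :
    Function.Injective (tensorMap T S P f) := by
  intro x y e
  refine hα (ModuleCat.of S L) (LinearMap.ext fun q => hf ?_)
  change f (M.pairingP.alpha L x q) = f (M.pairingP.alpha L y q)
  rw [← alpha_naturality, ← alpha_naturality, e]

/-- By `alpha_homMod_apply`, the hypothesis says that `alpha x = 0`. -/
theorem eq_zero_of_formT_smul_omega {K : Type u} [AddCommGroup K] [Module T K]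
    {x : BalTensor S P (HomMod T S P K)} (hx : ∀ p q, M.formT p q • omega T S P K x = 0) :
    x = 0 := by
  refine hα (ModuleCat.of S (HomMod T S P K)) (LinearMap.ext fun q => HomMod.ext (S := S) fun p => ?_)
  refine (M.alpha_homMod_apply x q p).trans ((hx p q).trans ?_)
  rw [map_zero]
  rfl

theorem omega_injective (K : Type u) [AddCommGroup K] [Module T K] :
    Function.Injective (omega T S P K) :=
  (injective_iff_map_eq_zero _).2 fun x hx =>
    eq_zero_of_formT_smul_omega hα fun p q => by rw [hx, smul_zero]

theorem gen_eq_stat : Gen T P = Stat T S P :=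
  le_antisymm (fun V hV => ⟨omega_injective hα V, omega_surjective_of_gen hV⟩) stat_le_gen

theorem eq_zero_of_formT_smul {V : ModuleCat.{u} T} (hV : Gen T P V) {v : V}
    (hv : ∀ p q, M.formT p q • v = 0) : v = 0 := by
  obtain ⟨x, rfl⟩ := omega_surjective_of_gen (S := S) hV v
  rw [eq_zero_of_formT_smul_omega hα hv, map_zero]

/-- Every element `v` of a `P`-generated module lies in `I v`, where `I` is the trace ideal of `T`:
the quotient by the span is `P`-generated, and `I` annihilates the image of `v` there. -/
theorem mem_span_formT_smul {V : ModuleCat.{u} T} (hV : Gen T P V) (v : V) :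
    v ∈ Submodule.span T {w : V | ∃ p q, w = M.formT p q • v} := by
  set N := Submodule.span T {w : V | ∃ p q, w = M.formT p q • v}
  have hVN : Gen T P (ModuleCat.of T (V ⧸ N)) := gen_quotient N.mkQ N.mkQ_surjective hV
  refine (Submodule.Quotient.mk_eq_zero N).1 (eq_zero_of_formT_smul hα hVN fun p q => ?_)
  exact (Submodule.Quotient.mk_eq_zero N).2 (Submodule.subset_span ⟨p, q, rfl⟩)

/-- Submodules of `P`-generated modules are `P`-generated: each element `v` is a combination of
the elements `⟨p, q⟩ v`, which are values of the maps `⟨-, q⟩ v` on `P`. -/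
theorem gen_submodule {V : ModuleCat.{u} T} (hV : Gen T P V) (N : Submodule T V) :
    Gen T P (ModuleCat.of T N) := by
  rw [gen_eq_stat hα]
  refine ⟨omega_injective hα N, fun v => ?_⟩
  let r := LinearMap.range (omega T S P N)
  have hle : Submodule.span T {w : V | ∃ p q, w = M.formT p q • (v : V)} ≤ r.map N.subtype := by
    refine Submodule.span_le.2 ?_
    rintro _ ⟨p, q, rfl⟩
    let h : P →ₗ[T] N :=
      { toFun := fun x => M.formT x q • v
        map_add' := fun x y => by simp [add_smul]
        map_smul' := fun t x => by simp [M.formT_smul_left, mul_smul] }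
    exact ⟨_, ⟨BalTensor.tmul S p (show HomMod T S P N from h), rfl⟩, rfl⟩
  obtain ⟨w, hw, hwv⟩ := hle (mem_span_formT_smul hα hV (v : V))
  rwa [Subtype.ext hwv] at hw

theorem gen_eq_pres : Gen T P = Pres T P := by
  refine le_antisymm (fun V hV => ?_) pres_le_gen
  obtain ⟨Λ₁, f, hf⟩ := hV
  have hΛ : Gen T P (ModuleCat.of T (Λ₁ →₀ P)) := ⟨Λ₁, LinearMap.id, Function.surjective_id⟩
  obtain ⟨Λ₂, g, hg⟩ := gen_submodule hα hΛ (LinearMap.ker f)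
  refine ⟨Λ₁, Λ₂, (LinearMap.ker f).subtype.comp g, f, fun y => ⟨fun hy => ?_, ?_⟩, hf⟩
  · obtain ⟨z, hz⟩ := hg ⟨y, hy⟩
    exact ⟨z, congrArg Subtype.val hz⟩
  · rintro ⟨z, rfl⟩
    exact (g z).2

theorem stat_isClosedUnderQuotients : (Stat T S P).IsClosedUnderQuotients := by
  rw [← gen_eq_stat hα]
  exact ⟨fun f _ hX => gen_quotient f.hom ((ModuleCat.epi_iff_surjective f).1 inferInstance) hX⟩

/-- The unit is invertible on every `Hom_T(P, K)`; since `P ⊗_S -` is exact, this passes to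
kernels of maps between such modules. -/
theorem copres_le_adstat (E : Type u) [AddCommGroup E] [Module T E] :
    Copres S (HomMod T S P E) ≤ Adstat T S P := by
  rintro L ⟨Λ₁, Λ₂, f, g, hf, hfg⟩
  let f' : L →ₗ[S] HomMod T S P (Λ₁ → E) := (HomMod.piEquiv Λ₁).symm.toLinearMap.comp f
  let g' : HomMod T S P (Λ₁ → E) →ₗ[S] HomMod T S P (Λ₂ → E) :=
    (HomMod.piEquiv Λ₂).symm.toLinearMap.comp (g.comp (HomMod.piEquiv Λ₁).toLinearMap)
  have hf' : Function.Injective f' := (HomMod.piEquiv Λ₁).symm.injective.comp hf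
  have hgf' : ∀ x, g' (f' x) = 0 := fun x => by
    simp [g', f', hfg.apply_apply_eq_zero]
  have hfg' : ∀ y, g' y = 0 → ∃ x, f' x = y := fun y hy => by
    obtain ⟨x, hx⟩ := (hfg _).1 ((HomMod.piEquiv Λ₂).symm.map_eq_zero_iff.1 hy)
    exact ⟨x, (LinearEquiv.symm_apply_eq _).2 hx⟩
  have eta₁ := eta_bijective_of_omega_injective (omega_injective hα (Λ₁ → E))
  have eta₂ := eta_bijective_of_omega_injective (omega_injective hα (Λ₂ → E))
  constructor
  · refine (injective_iff_map_eq_zero _).2 fun l hl => hf' (eta₁.1 ?_)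
    rw [eta_naturality, hl, map_zero, map_zero, map_zero]
  · intro k
    obtain ⟨x, hx⟩ := eta₁.2 (HomMod.map (tensorMap T S P f') k)
    -- `eta (g' x)` vanishes because it is `k` followed by `P ⊗ (g' ∘ f') = 0`
    have hgx : g' x = 0 := eta₂.1 (by
      rw [eta_naturality, hx, map_zero]
      refine HomMod.ext fun p => ?_
      change tensorMap T S P g' (tensorMap T S P f' (k p)) = 0
      generalize k p = y
      induction y using BalTensor.induction_on with
      | zero => simp
      | tmul p l => rw [tensorMap_tmul, tensorMap_tmul, hgf', ← eta_apply (T := T), map_zero]; rfl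
      | add x y hx hy => rw [map_add, map_add, hx, hy, add_zero])
    obtain ⟨l, rfl⟩ := hfg' x hgx
    refine ⟨l, HomMod.ext fun p => tensorMap_injective hα hf' ?_⟩
    exact DFunLike.congr_fun hx p

theorem copres_eq_adstat {E : Type u} [AddCommGroup E] [Module T E] (hE : IsCogenerator T E) :
    Copres S (HomMod T S P E) = Adstat T S P :=
  le_antisymm (copres_le_adstat hα E) (adstat_le_copres hE)

end Alpha

/-! ### Change of rings to the endomorphism ring -/

section EndRing

variable {L : Type u} [AddCommGroup L] [Module S L] [Module (Module.End T P)ᵐᵒᵖ L]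
  (hL : ∀ (s : S) (l : L), s • l = (op (rmul T S P s) : (Module.End T P)ᵐᵒᵖ) • l)

/-- The canonical map `P ⊗_S L → P ⊗_{S'} L`, where `S' = End(_T P)^op` and the action of `S` on
`L` is induced by that of `S'`. -/
def toEndTensor : BalTensor S P L →+ BalTensor (Module.End T P)ᵐᵒᵖ P L :=
  BalTensor.lift S
    (AddMonoidHom.mk' (fun p => AddMonoidHom.mk' (fun l => BalTensor.tmul _ p l)
      (fun l l' => BalTensor.tmul_add _ p l l'))
      (fun p p' => AddMonoidHom.ext fun l => BalTensor.add_tmul _ p p' l))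
    (fun p s l => by
      change BalTensor.tmul _ (op s • p) l = BalTensor.tmul _ p (s • l)
      rw [hL, ← BalTensor.smul_tmul]
      rfl)

theorem toEndTensor_surjective : Function.Surjective (toEndTensor hL) := by
  intro x
  induction x using BalTensor.induction_on with
  | zero => exact ⟨0, map_zero _⟩
  | tmul p l => exact ⟨BalTensor.tmul S p l, rfl⟩
  | add x y hx hy =>
    obtain ⟨x, rfl⟩ := hx
    obtain ⟨y, rfl⟩ := hy
    exact ⟨x + y, map_add _ _ _⟩

include hL in
/-- For an endomorphism `φ` of `P`, right multiplication by `⟨q, φ p⟩` is right multiplication by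
`⟨q, p⟩` followed by `φ`, because both send `x` to `⟨x, q⟩ φ p`. -/
theorem formS_end_smul (φ : Module.End T P) (q : Q) (p : P) (l : L) :
    M.formS q (φ p) • l = M.formS q p • (op φ : (Module.End T P)ᵐᵒᵖ) • l := by
  rw [hL, hL, ← mul_smul, ← op_mul]
  congr 2
  ext x
  change op (M.formS q (φ p)) • x = φ (op (M.formS q p) • x)
  rw [M.compat_P, M.compat_P, map_smul]

variable {M} (hα : M.pairingP.IsAlpha)
include hα

/-- `alpha` factors through `P ⊗_{S'} L`. -/
theorem toEndTensor_injective : Function.Injective (toEndTensor hL) := by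
  let β : BalTensor (Module.End T P)ᵐᵒᵖ P L →+ (Q →ₗ[S] L) :=
    BalTensor.lift _
      (AddMonoidHom.mk' (fun p => AddMonoidHom.mk'
        (fun l => M.pairingP.alpha L (BalTensor.tmul S p l))
        (fun l l' => by rw [BalTensor.tmul_add, map_add]))
        (fun p p' => AddMonoidHom.ext fun l => by
          change M.pairingP.alpha L (BalTensor.tmul S (p + p') l) =
            M.pairingP.alpha L (BalTensor.tmul S p l) + M.pairingP.alpha L (BalTensor.tmul S p' l)
          rw [BalTensor.add_tmul, map_add]))
      (fun p φ l => LinearMap.ext fun q => M.formS_end_smul hL (unop φ) q p l)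
  have hβ : β.comp (toEndTensor hL) = M.pairingP.alpha L :=
    BalTensor.addHom_ext S fun p l => rfl
  refine Function.Injective.of_comp (f := β) ?_
  rw [← AddMonoidHom.coe_comp, hβ]
  exact hα (ModuleCat.of S L)

/-- Over `S'` the counit at `K` is still injective, since its composite with the bijection
`P ⊗_S Hom_T(P, K) ≅ P ⊗_{S'} Hom_T(P, K)` is the counit over `S`. -/
theorem omega_end_injective (K : Type u) [AddCommGroup K] [Module T K] :
    Function.Injective (omega T (Module.End T P)ᵐᵒᵖ P K) := by
  let : Module (Module.End T P)ᵐᵒᵖ (HomMod T S P K) :=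
    inferInstanceAs (Module _ (HomMod T (Module.End T P)ᵐᵒᵖ P K))
  have hL : ∀ (s : S) (h : HomMod T S P K),
      s • h = (op (rmul T S P s) : (Module.End T P)ᵐᵒᵖ) • h := fun _ _ => rfl
  refine (injective_iff_map_eq_zero _).2 fun x hx => ?_
  obtain ⟨y, rfl⟩ := toEndTensor_surjective hL x
  have hy : ∀ y : BalTensor S P (HomMod T S P K),
      omega T (Module.End T P)ᵐᵒᵖ P K (toEndTensor hL y) = omega T S P K y := by
    intro y
    induction y using BalTensor.induction_on with
    | zero => rw [map_zero, map_zero]; exact map_zero _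
    | tmul p h => rfl
    | add x y hx hy => rw [map_add, map_add, ← hx, ← hy]; exact map_add _ _ _
  rw [omega_injective hα K ((hy y).symm.trans (hx.trans (map_zero _).symm)), map_zero]
  rfl

theorem gen_eq_stat_end : Gen T P = Stat T (Module.End T P)ᵐᵒᵖ P :=
  le_antisymm (fun V hV => ⟨omega_end_injective hα V, omega_surjective_of_gen hV⟩) stat_le_gen

theorem sigmaSelfStatic : SigmaSelfStatic T P := fun Λ => by
  rw [← gen_eq_stat_end hα]
  exact ⟨Λ, LinearMap.id, Function.surjective_id⟩

/-- Restriction of scalars along `S → S'` changes neither `P ⊗ L` nor the unit map, and it sends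
modules cogenerated by `Hom_T(P, E)` to such modules. -/
theorem cogen_end_le_adstat {E : Type u} [AddCommGroup E] [Module T E]
    (h : Cogen S (HomMod T S P E) ≤ Adstat T S P) :
    Cogen (Module.End T P)ᵐᵒᵖ (HomMod T (Module.End T P)ᵐᵒᵖ P E) ≤
      Adstat T (Module.End T P)ᵐᵒᵖ P := by
  intro L hL
  obtain ⟨Λ, f, hf⟩ := hL
  let ψ : S →+* (Module.End T P)ᵐᵒᵖ :=
    { toFun := fun s => op (rmul T S P s)
      map_one' := congrArg op (LinearMap.ext fun p => one_smul Sᵐᵒᵖ p)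
      map_mul' := fun s s' => congrArg op (LinearMap.ext fun p => mul_smul (op s') (op s) p)
      map_zero' := congrArg op (LinearMap.ext fun p => zero_smul Sᵐᵒᵖ p)
      map_add' := fun s s' => congrArg op (LinearMap.ext fun p => add_smul (op s) (op s') p) }
  let : Module S L := Module.compHom L ψ
  have hS : ∀ (s : S) (l : L), s • l = (op (rmul T S P s) : (Module.End T P)ᵐᵒᵖ) • l :=
    fun _ _ => rfl
  have hcog : Cogen S (HomMod T S P E) (ModuleCat.of S L) :=
    ⟨Λ, { toFun := fun l => f l
          map_add' := f.map_add
          map_smul' := fun s l => f.map_smul (ψ s) l }, hf⟩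
  have heta := h _ hcog
  have hc : Function.Bijective (toEndTensor (T := T) (P := P) hS) :=
    ⟨toEndTensor_injective hS hα, toEndTensor_surjective hS⟩
  let c : BalTensor S P L ≃ₗ[T] BalTensor (Module.End T P)ᵐᵒᵖ P L :=
    LinearEquiv.ofBijective
      { toFun := toEndTensor hS
        map_add' := map_add _
        map_smul' := fun t x => by
          induction x using BalTensor.induction_on with
          | zero => simp
          | tmul p l => rfl
          | add x y hx hy => simp only [smul_add, map_add, hx, hy] } hc
  constructor
  · intro l l' e
    refine heta.1 (HomMod.ext fun p => c.injective ?_)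
    exact DFunLike.congr_fun e p
  · intro k
    obtain ⟨l, hl⟩ := heta.2 (c.symm.toLinearMap.comp (k : P →ₗ[T] _) : P →ₗ[T] _)
    refine ⟨l, HomMod.ext fun p => ?_⟩
    exact (c.symm_apply_eq.1 (DFunLike.congr_fun hl p).symm).symm

end EndRing

/-! ### Localized modules and the full `α`-condition -/

section Localized

/-- The bimodule map `Q ⊗_T P → J` onto the trace ideal, as an `S`-linear map. -/
def toTraceS : BalTensor T Q P →ₗ[S] M.traceS :=
  LinearMap.codRestrict M.traceS
    { toFun := BalTensor.lift T M.formS M.formS_balanced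
      map_add' := map_add _
      map_smul' := fun s x => by
        induction x using BalTensor.induction_on with
        | zero => simp
        | tmul q p => exact M.formS_smul_left s q p
        | add x y hx hy => simp only [smul_add, map_add, hx, hy] }
    (fun x => by
      induction x using BalTensor.induction_on with
      | zero => rw [map_zero]; exact zero_mem _
      | tmul q p => exact Submodule.subset_span ⟨q, p, rfl⟩
      | add x y hx hy => rw [map_add]; exact add_mem hx hy)

theorem coe_toTraceS_tmul (q : Q) (p : P) :
    (M.toTraceS (BalTensor.tmul T q p) : S) = M.formS q p := rfl

theorem toTraceS_surjective : Function.Surjective M.toTraceS := by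
  rintro ⟨j, hj⟩
  suffices h : M.traceS ≤ (LinearMap.range M.toTraceS).map M.traceS.subtype by
    obtain ⟨_, ⟨x, rfl⟩, hx⟩ := h hj
    exact ⟨x, Subtype.ext hx⟩
  refine Submodule.span_le.2 ?_
  rintro _ ⟨q, p, rfl⟩
  exact ⟨_, ⟨BalTensor.tmul T q p, rfl⟩, rfl⟩

/-- The embedding of `Q ⊗_T P` into `Hom_T(P, P)` sends `x` to right multiplication by its image
in `J`. -/
theorem alpha_pairingQ_apply (x : BalTensor T Q P) (p : P) :
    M.pairingQ.alpha P x p = op (M.toTraceS x : S) • p := by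
  induction x using BalTensor.induction_on with
  | zero => simp
  | tmul q p' => exact (M.compat_P p q p').symm
  | add x y hx hy => rw [map_add, map_add, LinearMap.add_apply, hx, hy, Submodule.coe_add, MulOpposite.op_add,
      add_smul]

theorem toTraceS_injective (hα : M.pairingQ.IsAlpha) : Function.Injective M.toTraceS := by
  refine (injective_iff_map_eq_zero _).2 fun x hx => hα (ModuleCat.of T P) ?_
  refine LinearMap.ext fun p => (M.alpha_pairingQ_apply x p).trans ?_
  rw [hx, map_zero]
  simp

variable {M}

/-- A map `g : P → P ⊗_S L` gives `J ≅ Q ⊗_T P → Q ⊗_T P ⊗_S L → L`. If it is multiplication by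
`l`, then `alpha` identifies `g` with `p ↦ p ⊗ l`. -/
theorem localized_le_adstat (hα : M.RightAlpha) : Localized M.traceS ≤ Adstat T S P := by
  intro L hL
  constructor
  · refine (injective_iff_map_eq_zero _).2 fun l hl => hL.1 (LinearMap.ext fun j => ?_)
    obtain ⟨x, rfl⟩ := M.toTraceS_surjective j
    change (M.toTraceS x : S) • l = (M.toTraceS x : S) • (0 : L)
    induction x using BalTensor.induction_on with
    | zero => simp
    | tmul q p =>
      rw [coe_toTraceS_tmul, ← alpha_tmul, ← eta_apply (T := T), hl, smul_zero]
      exact LinearMap.congr_fun (map_zero (M.pairingP.alpha L)) q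
    | add x y hx hy => simp only [map_add, Submodule.coe_add, add_smul, hx, hy]
  · intro g
    let γ : BalTensor T Q P →ₗ[S] L :=
      { toFun := BalTensor.lift T
          (AddMonoidHom.mk' (fun q => AddMonoidHom.mk' (fun p => M.pairingP.alpha L (g p) q)
            (fun p p' => by
              rw [HomMod.apply_add, map_add]; rfl))
            (fun q q' => AddMonoidHom.ext fun p => map_add (M.pairingP.alpha L (g p)) q q'))
          (fun q t p => by
            change M.pairingP.alpha L (g p) (op t • q) = M.pairingP.alpha L (g (t • p)) q
            rw [HomMod.apply_smul]
            generalize g p = y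
            induction y using BalTensor.induction_on with
            | zero => simp
            | tmul p l =>
              rw [BalTensor.tsmul_tmul, alpha_tmul, alpha_tmul, M.formS_balanced]
            | add x y hx hy => simp only [smul_add, map_add, LinearMap.add_apply, hx, hy])
        map_add' := map_add _
        map_smul' := fun s x => by
          induction x using BalTensor.induction_on with
          | zero => simp
          | tmul q p => exact map_smul (M.pairingP.alpha L (g p)) s q
          | add x y hx hy => simp only [smul_add, map_add, hx, hy] }
    let e : BalTensor T Q P ≃ₗ[S] M.traceS :=
      LinearEquiv.ofBijective M.toTraceS ⟨M.toTraceS_injective hα.1, M.toTraceS_surjective⟩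
    obtain ⟨l, hl⟩ := hL.2 (γ.comp e.symm.toLinearMap)
    refine ⟨l, HomMod.ext fun p => hα.2 L (LinearMap.ext fun q => ?_)⟩
    have h := LinearMap.congr_fun hl (e (BalTensor.tmul T q p))
    exact h.trans (congrArg γ (e.symm_apply_apply _))

end Localized

/-! ### Tilting properties -/

section Tilting

variable {M} (hα : M.pairingP.IsAlpha) {E : Type u} [AddCommGroup E] [Module T E]
  (hE : IsCogenerator T E) (hAd : Cogen S (HomMod T S P E) ≤ Adstat T S P)
include hα hE hAd

/-- An `S`-submodule `C` of `Hom_T(P, V)` whose members jointly generate `V` is everything. The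
map `P ⊗_S C → V` is an isomorphism, so a map `h : P → V` amounts to a map `P → P ⊗_S C`; as `C`
is adstatic, the latter is `p ↦ p ⊗ c` for some `c ∈ C`, and then `h = c`. -/
theorem submodule_homMod_eq_top {V : Type u} [AddCommGroup V] [Module T V]
    (C : Submodule S (HomMod T S P V))
    (hC : Submodule.span T {v : V | ∃ h ∈ C, ∃ p, v = h p} = ⊤) : C = ⊤ := by
  let w : BalTensor S P C →ₗ[T] V := (omega T S P V).comp (tensorMap T S P C.subtype)
  have hw : Function.Bijective w := by
    refine ⟨(omega_injective hα V).comp (tensorMap_injective hα C.subtype_injective),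
      LinearMap.range_eq_top.1 (top_unique (hC.ge.trans (Submodule.span_le.2 ?_)))⟩
    rintro _ ⟨h, hh, p, rfl⟩
    exact ⟨BalTensor.tmul S p (⟨h, hh⟩ : C), rfl⟩
  let e := LinearEquiv.ofBijective w hw
  have heta := hAd (ModuleCat.of S C)
    (cogen_homMod_of_injective (V := ModuleCat.of T V) hE C.subtype C.subtype_injective)
  refine top_unique fun h _ => ?_
  obtain ⟨c, hc⟩ := heta.2 (e.symm.toLinearMap.comp (h : P →ₗ[T] V) : P →ₗ[T] BalTensor S P C)
  have hch : (c : HomMod T S P V) = h := HomMod.ext fun p =>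
    e.symm_apply_eq.1 (DFunLike.congr_fun hc p).symm |>.symm
  exact hch ▸ c.2

/-- The maps `P → V` that lift along `g : P^(Λ) → V` form a submodule generating `V`. -/
theorem weaklySigmaQuasiProjective : WeaklySigmaQuasiProjective T P := by
  intro Λ K V i g _ hi hig hg
  refine ⟨fun h h' e => LinearMap.ext fun p => hi (LinearMap.congr_fun e p),
    HomMod.exact_map (S := S) hi hig, ?_⟩
  suffices h : LinearMap.range (HomMod.map g : HomMod T S P (Λ →₀ P) →ₗ[S] _) = ⊤ from
    LinearMap.range_eq_top.1 h
  refine submodule_homMod_eq_top hα hE hAd _ (top_unique fun v _ => ?_)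
  obtain ⟨y, rfl⟩ := hg v
  induction y using Finsupp.induction_linear with
  | zero => rw [map_zero]; exact zero_mem _
  | add y z hy hz => rw [map_add]; exact add_mem (hy trivial) (hz trivial)
  | single a p =>
    exact Submodule.subset_span ⟨_, ⟨(Finsupp.lsingle a : P →ₗ[T] (Λ →₀ P)), rfl⟩, p, rfl⟩

/-- The maps `P → P^(Λ)` with values in a finite subsum form a submodule generating `P^(Λ)`. -/
theorem selfSmall : SelfSmall T P := by
  intro Λ
  let σ : (Λ →₀ HomMod T S P P) →ₗ[S] HomMod T S P (Λ →₀ P) :=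
    Finsupp.lsum ℕ fun a => HomMod.map (Finsupp.lsingle a)
  have hσ : ∀ (f : Λ →₀ HomMod T S P P) (p : P) (a : Λ), (σ f p : Λ →₀ P) a = f a p := by
    intro f p a
    induction f using Finsupp.induction_linear with
    | zero => rw [map_zero]; rfl
    | add f f' hf hf' =>
      rw [map_add]
      exact congrArg₂ (· + ·) hf hf'
    | single b h =>
      rw [show σ (Finsupp.single b h) = HomMod.map (Finsupp.lsingle b) h from
        Finsupp.sum_single_index (map_zero _), HomMod.map_apply]
      classical
      rw [Finsupp.lsingle_apply, Finsupp.single_apply, Finsupp.single_apply]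
      split_ifs <;> rfl
  -- the canonical map is the underlying function of `σ`
  change Function.Bijective σ
  constructor
  · intro f f' e
    refine Finsupp.ext fun a => HomMod.ext fun p => ?_
    rw [← hσ, ← hσ, e]
  · refine LinearMap.range_eq_top.1
      (submodule_homMod_eq_top hα hE hAd _ (top_unique fun y _ => ?_))
    induction y using Finsupp.induction_linear with
    | zero => exact zero_mem _
    | add y z hy hz => exact add_mem (hy trivial) (hz trivial)
    | single a p =>
      let i : HomMod T S P P := (LinearMap.id : P →ₗ[T] P)
      refine Submodule.subset_span ⟨_, ⟨Finsupp.single a i, rfl⟩, p, ?_⟩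
      refine Finsupp.ext fun b => ?_
      rw [hσ]
      classical
      rw [Finsupp.single_apply, Finsupp.single_apply]
      split_ifs <;> rfl

/-- Over `S'` the static modules are again `Gen(P)`, and the adstatic ones lie between
`Cogen(Hom_T(P, E))` and `Copres(Hom_T(P, E))`, hence equal both. -/
theorem isStarModule : IsStarModule T P E := by
  have h := inducesEquivalence_stat_adstat T (Module.End T P)ᵐᵒᵖ P
  rw [← gen_eq_stat_end hα, ← le_antisymm (cogen_end_le_adstat hα hAd)
    ((adstat_le_copres hE).trans copres_le_cogen)] at h
  exact h

end Tilting

end MoritaContext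

end StarModules

open StarModules in
theorem mainTheorem6 {T S : Type u} [Ring T] [Ring S]
    {P : Type u} [AddCommGroup P] [Module T P] [Module Sᵐᵒᵖ P] [SMulCommClass T Sᵐᵒᵖ P]
    {Q : Type u} [AddCommGroup Q] [Module S Q] [Module Tᵐᵒᵖ Q] [SMulCommClass S Tᵐᵒᵖ Q]
    (M : MoritaContext T S P Q)
    (E : Type u) [AddCommGroup E] [Module T E] (hE_inj : Module.Injective T E)
    (hE_cog : IsCogenerator T E) :
    (M.pairingP.IsAlpha →
      Gen T P = Stat T S P ∧
      InducesEquivalence T S P (Gen T P) (Copres S (HomMod T S P E)) ∧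
      SigmaSelfStatic T P ∧
      (Stat T S P).IsClosedUnderQuotients ∧
      Gen T P = Pres T P) ∧
    (M.RightAlpha → Cogen S (HomMod T S P E) ≤ Localized M.traceS →
      Gen T P = Stat T S P ∧
      Cogen S (HomMod T S P E) = Adstat T S P ∧
      InducesEquivalence T S P (Gen T P) (Cogen S (HomMod T S P E)) ∧
      IsStarModule T P E ∧
      SelfTilting T P ∧
      SelfSmall T P) := by
  have hequiv := inducesEquivalence_stat_adstat T S P
  refine ⟨fun hα => ⟨MoritaContext.gen_eq_stat hα, ?_, MoritaContext.sigmaSelfStatic hα,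
    MoritaContext.stat_isClosedUnderQuotients hα, MoritaContext.gen_eq_pres hα⟩,
    fun hα hloc => ?_⟩
  · rwa [MoritaContext.gen_eq_stat hα, MoritaContext.copres_eq_adstat hα hE_cog]
  · have hAd : Cogen S (HomMod T S P E) ≤ Adstat T S P :=
      hloc.trans (MoritaContext.localized_le_adstat hα)
    have hcog : Cogen S (HomMod T S P E) = Adstat T S P :=
      le_antisymm hAd ((adstat_le_copres hE_cog).trans copres_le_cogen)
    refine ⟨MoritaContext.gen_eq_stat hα.2, hcog, ?_,
      MoritaContext.isStarModule hα.2 hE_cog hAd,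
      ⟨MoritaContext.weaklySigmaQuasiProjective hα.2 hE_cog hAd,
        MoritaContext.gen_eq_pres hα.2⟩,
      MoritaContext.selfSmall hα.2 hE_cog hAd⟩
    rwa [MoritaContext.gen_eq_stat hα.2, hcog]
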